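/- An \emph{effect algebra} is a partial algebra $(E;\oplus,0,1)$ with a partial binary operation $\oplus$ and constants $0,1$ such that: (E1) if $a\oplus b$ is defined, then $b\oplus a$ is defined and $a\oplus b=b\oplus a$; (E2) if $a\oplus b$ and $(a\oplus b)\oplus c$ are defined, then $b\oplus c$ and $a\oplus(b\oplus c)$ are defined and $(a\oplus b)\oplus c=a\oplus(b\oplus c)$; (E3) for every $a\in E$ there is a unique $a'\in E$ with $a\oplus a'=1$; (E4) if $a\oplus 1$ is defined, then $a=0$. Write $a\perp b$ if $a\oplus b$ is defined, and $a\le b$ if $a\oplus c=b$ for some $c\in E$; this is a partial order on $E$. An effect algebra $E$ is - an \emph{orthoalgebra} if $a\perp a$ implies $a=0$ for all $a\in E$; - \emph{lattice-ordered} if any two elements of $(E,\le)$ have a supremum and an infimum; - said to have the \emph{Riesz decomposition property} if, for all $n$ and all $u,v_1,\dots,v_n\in E$ such that $v_1\oplus\dots\oplus v_n$ exists and $u\le v_1\oplus\dots\oplus v_n$, there are $u_1,\dots,u_n\in E$ with $u_i\le v_i$ for $1\le i\le n$ and $u=u_1\oplus\dots\oplus u_n$ (the empty sum being $0$); - \emph{homogeneous}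 if, for all $u,v_1,v_2\in E$ such that $v_1\perp v_2$, $u\le v_1\oplus v_2$ and $u\le (v_1\oplus v_2)'$, there are $u_1,u_2\in E$ with $u_1\le v_1$, $u_2\le v_2$ and $u=u_1\oplus u_2$. **Proposition.** (a) Every orthoalgebra is homogeneous. (b) Every effect algebra with the Riesz decomposition property is homogeneous. (c) Every lattice-ordered effect algebra is homogeneous. -/

import Mathlib

/-- An effect algebra: a partial algebra `(E; ⊕, 0, 1)`.  The partial operation is modelled by an
`Option`-valued map: `oplus a b = some c` says that `a ⊕ b` is defined and equal to `c`, and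
`oplus a b = none` says that `a ⊕ b` is undefined. -/
class EffectAlgebra (E : Type*) extends Zero E, One E where
  oplus : E → E → Option E
  oplus_comm : ∀ a b c : E, oplus a b = some c → oplus b a = some c
  oplus_assoc : ∀ a b c d e : E, oplus a b = some d → oplus d c = some e →
    ∃ f, oplus b c = some f ∧ oplus a f = some e
  existsUnique_orthosupplement : ∀ a : E, ∃! b : E, oplus a b = some 1
  eq_zero_of_oplus_one : ∀ a b : E, oplus a 1 = some b → a = 0

namespace EffectAlgebra

section Basic

variable {E : Type*} [EffectAlgebra E]

/-- The orthosupplement `a'`, the unique element with `a ⊕ a' = 1`. -/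
noncomputable def orthosupplement (a : E) : E :=
  (existsUnique_orthosupplement a).choose

theorem oplus_orthosupplement (a : E) : oplus a (orthosupplement a) = some 1 :=
  (existsUnique_orthosupplement a).choose_spec.1

theorem oplus_zero (a : E) : oplus a 0 = some a := by
  have h1 : oplus (1 : E) 0 = some 1 := by
    have h := oplus_orthosupplement (1 : E)
    have h0 := eq_zero_of_oplus_one _ _ (oplus_comm _ _ _ h)
    rwa [h0] at h
  have ha := oplus_comm _ _ _ (oplus_orthosupplement a)
  obtain ⟨f, hf, hf'⟩ := oplus_assoc _ _ _ _ _ ha h1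
  rw [hf, (existsUnique_orthosupplement (orthosupplement a)).unique hf' ha]

theorem oplus_left_cancel {a b c d : E} (hb : oplus a b = some d) (hc : oplus a c = some d) :
    b = c := by
  have hd := oplus_orthosupplement d
  obtain ⟨f, hf, hbf⟩ := oplus_assoc _ _ _ _ _ (oplus_comm _ _ _ hb) hd
  obtain ⟨g, hg, hcg⟩ := oplus_assoc _ _ _ _ _ (oplus_comm _ _ _ hc) hd
  obtain rfl : f = g := Option.some.inj (hf.symm.trans hg)
  exact (existsUnique_orthosupplement f).unique (oplus_comm _ _ _ hbf) (oplus_comm _ _ _ hcg)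

theorem eq_zero_of_oplus_eq_zero {a b : E} (h : oplus a b = some 0) : b = 0 := by
  obtain ⟨f, hf, -⟩ := oplus_assoc _ _ _ _ _ h (oplus_comm _ _ _ (oplus_zero (1 : E)))
  exact eq_zero_of_oplus_one _ _ hf

/-- The order of an effect algebra: `a ≤ b` iff there is `c` with `a ⊕ c = b`. -/
instance : PartialOrder E where
  le a b := ∃ c, oplus a c = some b
  le_refl a := ⟨0, oplus_zero a⟩
  le_trans := by
    rintro a b c ⟨x, hx⟩ ⟨y, hy⟩
    obtain ⟨f, -, hf⟩ := oplus_assoc _ _ _ _ _ hx hy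
    exact ⟨f, hf⟩
  le_antisymm := by
    rintro a b ⟨x, hx⟩ ⟨y, hy⟩
    obtain ⟨f, hf, haf⟩ := oplus_assoc _ _ _ _ _ hx hy
    obtain rfl : f = 0 := oplus_left_cancel haf (oplus_zero a)
    obtain rfl : x = 0 := eq_zero_of_oplus_eq_zero (oplus_comm _ _ _ hf)
    exact Option.some.inj ((oplus_zero a).symm.trans hx)

theorem le_iff {a b : E} : a ≤ b ↔ ∃ c, oplus a c = some b := Iff.rfl

/-- The orthosum of a finite list, `c₁ ⊕ (c₂ ⊕ (⋯ ⊕ (cₙ ⊕ 0)))`; it is `some s` if the sum exists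
and equals `s`, and `none` if it does not exist.  The empty sum is `0`, and by associativity the
bracketing is immaterial. -/
def listSum : List E → Option E
  | [] => some 0
  | a :: l => (listSum l).bind fun s => oplus a s

/-- The orthosum `v₁ ⊕ ⋯ ⊕ vₙ` of a finite family. -/
def finSum {n : ℕ} (v : Fin n → E) : Option E := listSum (List.ofFn v)

end Basic

/-- `a ⟂ b`: the sum `a ⊕ b` is defined. -/
def Orthogonal {E : Type*} [EffectAlgebra E] (a b : E) : Prop := ∃ c, oplus a b = some c

/-- An orthoalgebra: an effect algebra in which `a ⟂ a` implies `a = 0`. -/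
def IsOrthoalgebra (E : Type*) [EffectAlgebra E] : Prop :=
  ∀ a : E, Orthogonal a a → a = 0

/-- The Riesz decomposition property. -/
def RieszDecomposition (E : Type*) [EffectAlgebra E] : Prop :=
  ∀ (n : ℕ) (v : Fin n → E) (u s : E), finSum v = some s → u ≤ s →
    ∃ w : Fin n → E, (∀ i, w i ≤ v i) ∧ finSum w = some u

/-- Lattice ordered: any two elements have a supremum and an infimum. -/
def IsLatticeOrdered (E : Type*) [EffectAlgebra E] : Prop :=
  ∀ a b : E, (∃ s, IsLUB {a, b} s) ∧ ∃ i, IsGLB {a, b} i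

/-- Homogeneous: if `v₁ ⊕ v₂` is defined, `u ≤ v₁ ⊕ v₂` and `u ≤ (v₁ ⊕ v₂)'`, then
`u = u₁ ⊕ u₂` for some `u₁ ≤ v₁` and `u₂ ≤ v₂`. -/
def IsHomogeneous (E : Type*) [EffectAlgebra E] : Prop :=
  ∀ u v₁ v₂ s : E, oplus v₁ v₂ = some s → u ≤ s → u ≤ orthosupplement s →
    ∃ u₁ u₂ : E, u₁ ≤ v₁ ∧ u₂ ≤ v₂ ∧ oplus u₁ u₂ = some u

end EffectAlgebra

/-!
If `u ≤ s'`, then `u` is orthogonal to every element below `s`. In an orthoalgebra this forces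
`u = 0`, since `u ≤ s` makes `u` orthogonal to itself. Otherwise let `s = v ⊕ w` and `t = v ⊕ u`.
Any `j` with `u, v ≤ j ≤ s, t` splits `u` as `(t ⊖ j) ⊕ (j ⊖ v)`, where `t ⊖ j ≤ t ⊖ u = v` and
`j ⊖ v ≤ s ⊖ v = w`; the supremum of `v` and `u` is such a `j`.
-/

namespace EffectAlgebra

variable {E : Type*} [EffectAlgebra E]

protected theorem zero_le (a : E) : 0 ≤ a :=
  ⟨a, oplus_comm _ _ _ (oplus_zero a)⟩

theorem Orthogonal.symm {a b : E} (h : Orthogonal a b) : Orthogonal b a :=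
  h.imp (oplus_comm a b)

theorem Orthogonal.mono_left {a b c : E} (h : Orthogonal b c) (hab : a ≤ b) :
    Orthogonal a c := by
  obtain ⟨d, hbc⟩ := h
  obtain ⟨x, hax⟩ := hab
  obtain ⟨e, hxc, -⟩ := oplus_assoc _ _ _ _ _ (oplus_comm _ _ _ hax) hbc
  exact ⟨e, hxc⟩

theorem Orthogonal.mono {a b c d : E} (h : Orthogonal b d) (hab : a ≤ b) (hcd : c ≤ d) :
    Orthogonal a c :=
  ((h.mono_left hab).symm.mono_left hcd).symm

theorem orthogonal_of_le_of_le_orthosupplement {a b s : E} (ha : a ≤ s)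
    (hb : b ≤ orthosupplement s) : Orthogonal a b :=
  Orthogonal.mono ⟨1, oplus_orthosupplement s⟩ ha hb

theorem oplus_assoc_left_cancel {a b c d e s : E} (hab : oplus a b = some c)
    (hcd : oplus c d = some s) (hae : oplus a e = some s) : oplus b d = some e := by
  obtain ⟨f, hbd, haf⟩ := oplus_assoc _ _ _ _ _ hab hcd
  rwa [oplus_left_cancel haf hae] at hbd

theorem exists_oplus_eq_of_interpolant {u v w s t j : E} (hs : oplus v w = some s)
    (ht : oplus v u = some t) (huj : u ≤ j) (hvj : v ≤ j) (hjs : j ≤ s) (hjt : j ≤ t) :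
    ∃ u₁ u₂ : E, u₁ ≤ v ∧ u₂ ≤ w ∧ oplus u₁ u₂ = some u := by
  obtain ⟨x, hux⟩ := huj
  obtain ⟨y, hvy⟩ := hvj
  obtain ⟨z, hjz⟩ := hjs
  obtain ⟨m, hjm⟩ := hjt
  have hxm : oplus x m = some v := oplus_assoc_left_cancel hux hjm (oplus_comm _ _ _ ht)
  have hyz : oplus y z = some w := oplus_assoc_left_cancel hvy hjz hs
  have hym : oplus y m = some u := oplus_assoc_left_cancel hvy hjm ht
  exact ⟨m, y, ⟨x, oplus_comm _ _ _ hxm⟩, ⟨z, hyz⟩, oplus_comm _ _ _ hym⟩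

theorem finSum_two (v : Fin 2 → E) : finSum v = oplus (v 0) (v 1) := by
  simp [finSum, listSum, oplus_zero]

theorem IsOrthoalgebra.isHomogeneous (hE : IsOrthoalgebra E) : IsHomogeneous E := by
  intro u v₁ v₂ s _ hus hus'
  obtain rfl : u = 0 := hE u (orthogonal_of_le_of_le_orthosupplement hus hus')
  exact ⟨0, 0, EffectAlgebra.zero_le v₁, EffectAlgebra.zero_le v₂, oplus_zero 0⟩

theorem RieszDecomposition.isHomogeneous (hE : RieszDecomposition E) : IsHomogeneous E := by
  intro u v₁ v₂ s hs hus _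
  obtain ⟨w, hwv, hwu⟩ := hE 2 ![v₁, v₂] u s ((finSum_two _).trans hs) hus
  exact ⟨w 0, w 1, hwv 0, hwv 1, (finSum_two w).symm.trans hwu⟩

theorem isHomogeneous_of_orthogonal_exists_isLUB
    (hE : ∀ a b : E, Orthogonal a b → ∃ j, IsLUB {a, b} j) : IsHomogeneous E := by
  intro u v₁ v₂ s hs hus hus'
  have hv₁s : v₁ ≤ s := ⟨v₂, hs⟩
  have hv₁u : Orthogonal v₁ u := orthogonal_of_le_of_le_orthosupplement hv₁s hus'
  obtain ⟨j, hj⟩ := hE v₁ u hv₁u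
  obtain ⟨t, ht⟩ := hv₁u
  have hj_le {b : E} (hv : v₁ ≤ b) (hu : u ≤ b) : j ≤ b := (isLUB_le_iff hj).2 (by simp [hv, hu])
  exact exists_oplus_eq_of_interpolant hs ht (hj.1 (by simp)) (hj.1 (by simp))
    (hj_le hv₁s hus) (hj_le ⟨u, ht⟩ ⟨v₁, oplus_comm _ _ _ ht⟩)

end EffectAlgebra

theorem mainTheorem6_general (E : Type*) [EffectAlgebra E] :
    (EffectAlgebra.IsOrthoalgebra E → EffectAlgebra.IsHomogeneous E) ∧
    (EffectAlgebra.RieszDecomposition E → EffectAlgebra.IsHomogeneous E) ∧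
    ((∀ a b : E, EffectAlgebra.Orthogonal a b → ∃ j, IsLUB {a, b} j) →
      EffectAlgebra.IsHomogeneous E) :=
  ⟨EffectAlgebra.IsOrthoalgebra.isHomogeneous, EffectAlgebra.RieszDecomposition.isHomogeneous,
    EffectAlgebra.isHomogeneous_of_orthogonal_exists_isLUB⟩

theorem mainTheorem6 (E : Type*) [EffectAlgebra E] :
    (EffectAlgebra.IsOrthoalgebra E → EffectAlgebra.IsHomogeneous E) ∧
    (EffectAlgebra.RieszDecomposition E → EffectAlgebra.IsHomogeneous E) ∧
    (EffectAlgebra.IsLatticeOrdered E → EffectAlgebra.IsHomogeneous E) :=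
  (mainTheorem6_general E).imp_right <| And.imp_right fun h hE => h fun a b _ => (hE a b).1
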